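/- Let $X$ be a real linear Polish space (a real topological vector space whose topology is separable and completely metrizable). A set $A\subset X$ is called \emph{Haar meager} if there are a Borel set $B\subset X$ with $A\subset B$, a nonempty compact metric space $K$ and a continuous function $g:K\to X$ such that $g^{-1}(B+x)$ is meager in $K$ for every $x\in X$. A set is called \emph{$\mathcal D$-measurable} if it is the union of a Borel set and a Haar meager set, and a function $f:D\to Y$ from a set $D\subset X$ to a topological space $Y$ is called \emph{$\mathcal D$-measurable} if $f^{-1}(U)$ is a $\mathcal D$-measurable subset of $X$ for each open set $U\subset Y$. Let $D\subset X$ be a nonempty open convex set, and let $S\subset X$ be a cone (that is, $tS\subset S$ for every real $t>0$) with $S\cup(-S)\cup\{0\}=X$. Let $Y$ be a real normed space with a partial order $\preccurlyeq$ such that (i) if $x\preccurlyeq y$, then $x+z\preccurlyeq y+z$ and $\alpha x\preccurlyeq\alpha y$ for all $x,y,z\in Y$ and $\alpha\in[0,\infty)$; (ii) if $0\preccurlyeq x\preccurlyeq y$, then $\|x\|\le\|y\|$ for all $x,y\in Y$. Let $n\ge 1$ be an integer and let $f:D\to Y$ be a $\mathcal D$-measurable function which is $n$-convex with respect to $S$,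 i.e. $$\Delta_h^{n+1}f(x)=\sum_{j=0}^{n+1}(-1)^{n+1-j}\binom{n+1}{j}f(x+jh)\succcurlyeq 0$$ for all $x\in D$ and $h\in S$ such that $x+ih\in D$ for $i\in\{0,1,\dots,n+1\}$. Then $f$ is continuous on $D$. -/

import Mathlib

open scoped Pointwise

/-- A subset `A` of an abelian Polish group `X` is Haar meager if there are a Borel set `B ⊇ A`,
a (nonempty) compact metric space `K` and a continuous `g : K → X` such that `g ⁻¹ (B + x)` is
meager in `K` for every `x ∈ X`. -/
def IsHaarMeager {X : Type*} [AddCommGroup X] [TopologicalSpace X] (A : Set X) : Prop :=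
  ∃ B : Set X, @MeasurableSet X (borel X) B ∧ A ⊆ B ∧
    ∃ (K : Type) (_ : MetricSpace K) (_ : CompactSpace K) (_ : Nonempty K) (g : K → X),
      Continuous g ∧ ∀ x : X, IsMeagre (g ⁻¹' ((fun b => b + x) '' B))

/-- A set is `𝒟`-measurable if it is the union of a Borel set and a Haar meager set. -/
def IsDMeasurableSet {X : Type*} [AddCommGroup X] [TopologicalSpace X] (A : Set X) : Prop :=
  ∃ B M : Set X, @MeasurableSet X (borel X) B ∧ IsHaarMeager M ∧ A = B ∪ M

/-- A function `f : D → Y` on a subset `D` of `X` is `𝒟`-measurable if, for every open `U ⊆ Y`,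
the set `f ⁻¹ (U)`, regarded as a subset of `X`, is `𝒟`-measurable. -/
def IsDMeasurableFun {X Y : Type*} [AddCommGroup X] [TopologicalSpace X] [TopologicalSpace Y]
    {D : Set X} (f : D → Y) : Prop :=
  ∀ U : Set Y, IsOpen U → IsDMeasurableSet (((↑) : D → X) '' (f ⁻¹' U))

/-- A cone in a real vector space: a set closed under multiplication by positive reals.
Neither convexity nor `0 ∈ S` nor pointedness is required. -/
def IsConeSet {X : Type*} [AddCommGroup X] [Module ℝ X] (S : Set X) : Prop :=
  ∀ x ∈ S, ∀ t : ℝ, 0 < t → t • x ∈ S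

/-- `f : D → Y` is `n`-convex with respect to `S` if
`Δ_h^{n+1} f(x) = ∑_{j=0}^{n+1} (-1)^{n+1-j} (n+1 choose j) f(x + j h) ≥ 0` whenever `h ∈ S` and
all the points `x + j h`, `j = 0, …, n + 1` (so in particular `x`), lie in `D`. -/
def IsNConvexWRT {X Y : Type*} [AddCommGroup X] [Module ℝ X]
    [AddCommGroup Y] [Module ℝ Y] [LE Y] (n : ℕ) (S : Set X) {D : Set X} (f : D → Y) : Prop :=
  ∀ x h : X, h ∈ S → ∀ hx : ∀ j : Fin (n + 2), x + ((j : ℕ) : ℝ) • h ∈ D,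
    0 ≤ ∑ j : Fin (n + 2),
      ((-1 : ℝ) ^ (n + 1 - (j : ℕ)) * ((n + 1).choose (j : ℕ) : ℝ)) •
        f ⟨x + ((j : ℕ) : ℝ) • h, hx j⟩

/-! The proof splits into local boundedness, which uses measurability and Baire category, and the
passage from local boundedness to continuity, which is algebra of differences.

Local boundedness. Two nonnegative differences, based at `y` and at `y - d`, contain `F y` with
coefficients of opposite sign, so bounds at the points `y + i • d`, `0 < |i| ≤ n + 1`, bound `F y`
(`IsNConvexWRT.norm_le`). Suppose `F` is unbounded near `x₀`, say `‖F (x₀ + u k)‖ > k` with `u k →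
0` very fast. Let `ε` run over sequences in a finite set `E` of integers and put `g ε = ∑ (ε k)⁻¹ •
u k`. Up to a small translation `z` making the Haar meager parts negligible, Baire category gives
one `m` such that, for a nonmeagre set of `ε`, all points `x₀ + i • (g ε + z)` with `i ∈ E`, `i ≠
0`, lie in a Borel set where `‖F‖ ≤ m`. For large `k` some `ε` permits an arbitrary change of its
`k`-th term within that set; the value `i` there turns the `i`-th point into `x₀ + u k + i • d` with
`d` independent of `i`. Hence `F (x₀ + u k)` is bounded independently of `k`, a contradiction.

Continuity. Nonnegative differences of order `n + 1` make those of order `n` monotone along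
progressions; since their sums telescope to bounded quantities, they tend to zero. Telescoping again
lowers the order step by step to one, which is continuity. -/

open Filter Topology TopologicalSpace Uniformity

/-! ### Complete metrizability and completeness -/

/-- The range of a dense embedding of a completely metrizable space into a Hausdorff space is a
`Gδ` set. -/
theorem isGδ_range_of_isDenseInducing {X Z : Type*} [TopologicalSpace X]
    [IsCompletelyMetrizableSpace X] [TopologicalSpace Z] [T2Space Z] {i : X → Z}
    (hi : IsDenseInducing i) : IsGδ (Set.range i) := by
  let := upgradeIsCompletelyMetrizable X
  -- A point lies in every `O n` exactly when the trace of its neighbourhood filter on `X` is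
  -- Cauchy.
  let O : ℕ → Set Z := fun n => ⋃₀ {U | IsOpen U ∧ ∀ a b, i a ∈ U → i b ∈ U →
    dist a b < 1 / ((n : ℝ) + 1)}
  have hO : ∀ n, IsOpen (O n) := fun n => isOpen_sUnion fun U hU => hU.1
  have : Set.range i = ⋂ n, O n := by
    apply Set.Subset.antisymm
    · rintro _ ⟨x, rfl⟩
      refine Set.mem_iInter.2 fun n => ?_
      have hpos : (0 : ℝ) < 1 / ((n : ℝ) + 1) / 2 := by positivity
      obtain ⟨U, hU, hUb⟩ := hi.isInducing.isOpen_iff.1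
        (Metric.isOpen_ball (x := x) (ε := 1 / ((n : ℝ) + 1) / 2))
      have hmem : ∀ a, i a ∈ U ↔ dist a x < 1 / ((n : ℝ) + 1) / 2 := fun a => by
        rw [← Metric.mem_ball, ← hUb]; rfl
      refine ⟨U, ⟨hU, fun a b ha hb => ?_⟩, (hmem x).2 (by simpa using hpos)⟩
      have := dist_triangle_right a b x
      linarith [(hmem a).1 ha, (hmem b).1 hb]
    · intro ξ hξ
      have hne : (comap i (𝓝 ξ)).NeBot := hi.comap_nhds_neBot ξ
      have hc : Cauchy (comap i (𝓝 ξ)) := by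
        refine Metric.cauchy_iff.2 ⟨hne, fun ε hε => ?_⟩
        obtain ⟨n, hn⟩ := exists_nat_one_div_lt hε
        obtain ⟨U, ⟨hU, hd⟩, hξU⟩ := Set.mem_iInter.1 hξ n
        exact ⟨i ⁻¹' U, preimage_mem_comap (hU.mem_nhds hξU),
          fun a ha b hb => (hd a b ha hb).trans hn⟩
      obtain ⟨x, hx⟩ := CompleteSpace.complete hc
      have h1 : Tendsto i (comap i (𝓝 ξ)) (𝓝 (i x)) := (hi.continuous.tendsto x).mono_left hx
      exact ⟨x, tendsto_nhds_unique h1 tendsto_comap⟩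
  rw [this]
  exact IsGδ.iInter_of_isOpen hO

/-- A completely metrizable abelian topological group is complete. -/
theorem completeSpace_of_isCompletelyMetrizableSpace (X : Type*) [AddCommGroup X] [UniformSpace X]
    [IsUniformAddGroup X] [IsCompletelyMetrizableSpace X] : CompleteSpace X := by
  have : (𝓤 (UniformSpace.Completion X)).IsCountablyGenerated := by
    obtain ⟨u, hu⟩ := (𝓝 (0 : X)).exists_antitone_basis
    have h0 := (hu.toHasBasis.hasBasis_of_isDenseInducing
      (UniformSpace.Completion.isDenseInducing_coe (α := X))).isCountablyGenerated
    rw [UniformSpace.Completion.coe_zero] at h0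
    rw [uniformity_eq_comap_nhds_zero]
    infer_instance
  have hG : IsGδ (Set.range ((↑) : X → UniformSpace.Completion X)) :=
    isGδ_range_of_isDenseInducing UniformSpace.Completion.isDenseInducing_coe
  have hd : Dense (Set.range ((↑) : X → UniformSpace.Completion X)) :=
    UniformSpace.Completion.denseRange_coe
  have hsurj : ∀ ξ : UniformSpace.Completion X, ξ ∈ Set.range ((↑) : X → UniformSpace.Completion X) := by
    intro ξ
    -- With `G` the range, both `G` and `ξ - G` are residual in the completion, so they meet, and
    -- `ξ` is a sum of two elements of the subgroup `G`.
    have h2 := tendsto_residual_of_isOpenMap (Homeomorph.subLeft ξ).continuous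
      (Homeomorph.subLeft ξ).isOpenMap (residual_of_dense_Gδ hG hd)
    obtain ⟨y, ⟨a, ha⟩, ⟨b, hb⟩⟩ := (dense_of_mem_residual
      (inter_mem (residual_of_dense_Gδ hG hd) h2)).nonempty
    refine ⟨b + a, ?_⟩
    have : ξ - y = (b : UniformSpace.Completion X) := hb.symm
    rw [UniformSpace.Completion.coe_add, ← this, ha, sub_add_cancel]
  have hr : Set.range ((↑) : X → UniformSpace.Completion X) = Set.univ :=
    Set.eq_univ_of_forall hsurj
  rw [completeSpace_iff_isComplete_range
    (UniformSpace.Completion.isUniformInducing_coe X), hr]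
  exact completeSpace_iff_isComplete_univ.1 inferInstance

/-! ### Infinite sums of small continuous functions -/

/-- In a Polish abelian group there are neighbourhoods `V j` of zero such that every series
`∑ g j (l j)` of continuous functions with values in `V j` converges to a continuous function on
the product, with values in a prescribed neighbourhood. -/
theorem exists_nhds_zero_forall_continuous_sum {X : Type*} [AddCommGroup X] [TopologicalSpace X]
    [IsTopologicalAddGroup X] [IsCompletelyMetrizableSpace X] {W : Set X} (hW : W ∈ 𝓝 (0 : X)) :
    ∃ V : ℕ → Set X, (∀ j, V j ∈ 𝓝 (0 : X)) ∧
      ∀ (L : ℕ → Type) [∀ j, TopologicalSpace (L j)] (g : ∀ j, L j → X),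
        (∀ j, Continuous (g j)) → (∀ j t, g j t ∈ V j) →
        ∃ h : (∀ j, L j) → X, Continuous h ∧ (∀ l, h l ∈ W) ∧
          ∀ l, Tendsto (fun N => ∑ j ∈ Finset.range N, g j (l j)) atTop (𝓝 (h l)) := by
  let : UniformSpace X := IsTopologicalAddGroup.rightUniformSpace X
  have : IsUniformAddGroup X := isUniformAddGroup_of_addCommGroup
  have : CompleteSpace X := completeSpace_of_isCompletelyMetrizableSpace X
  obtain ⟨W', hW', hW'c, hWW⟩ := exists_mem_nhds_isClosed_subset hW
  obtain ⟨u, hu, hadd⟩ := IsTopologicalAddGroup.exists_antitone_basis_nhds_zero X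
  obtain ⟨k, hk⟩ := hu.mem_iff.1 hW'
  have hu0 : ∀ j, (0 : X) ∈ u j := fun j => mem_of_mem_nhds (hu.mem j)
  -- Since `u (j + 1) + u (j + 1) ⊆ u j`, any block of terms starting at index `m` sums into `u (m +
  -- k)`; the induction below peels off the first term of the block.
  refine ⟨fun j => u (j + k + 1), fun j => hu.mem _, fun L _ g hg hgV => ?_⟩
  set s : ℕ → (∀ j, L j) → X := fun N l => ∑ j ∈ Finset.range N, g j (l j) with hs
  have key : ∀ l d m, s (m + d) l - s m l ∈ u (m + k) := by
    intro l d
    induction d with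
    | zero => intro m; simpa using hu0 _
    | succ d ih =>
      intro m
      have h1 : s (m + (d + 1)) l - s m l = g m (l m) + (s (m + 1 + d) l - s (m + 1) l) := by
        have : s (m + 1) l = s m l + g m (l m) := Finset.sum_range_succ _ _
        rw [this, show m + (d + 1) = m + 1 + d by ring]
        abel
      rw [h1]
      refine hadd (m + k) (Set.add_mem_add (hgV m (l m)) ?_)
      rw [show m + k + 1 = m + 1 + k by ring]
      exact ih (m + 1)
  have hunif : UniformCauchySeqOn s atTop Set.univ := by
    intro U hU
    rw [uniformity_eq_comap_nhds_zero, mem_comap] at hU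
    obtain ⟨t, ht, htU⟩ := hU
    obtain ⟨t', ht', hsub⟩ : ∃ t' ∈ 𝓝 (0 : X), ∀ a ∈ t', ∀ b ∈ t', a - b ∈ t := by
      have : Tendsto (fun p : X × X => p.1 - p.2) (𝓝 (0 : X) ×ˢ 𝓝 (0 : X)) (𝓝 0) := by
        have := (continuous_fst.sub continuous_snd : Continuous fun p : X × X => p.1 - p.2).tendsto
          (0, 0)
        simpa [nhds_prod_eq, Pi.sub_def] using this
      obtain ⟨t', ht', h⟩ := mem_prod_same_iff.1 (this ht)
      exact ⟨t', ht', fun a ha b hb => h (Set.mk_mem_prod ha hb)⟩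
    obtain ⟨m, hm⟩ := hu.mem_iff.1 ht'
    filter_upwards [prod_mem_prod (Ici_mem_atTop m) (Ici_mem_atTop m)] with p hp l _
    have hin : ∀ q, m ≤ q → s q l - s m l ∈ t' := fun q hq => by
      obtain ⟨d, rfl⟩ := Nat.exists_eq_add_of_le hq
      exact hm (hu.antitone (Nat.le_add_right m k) (key l d m))
    refine htU ?_
    have := hsub _ (hin p.2 hp.2) _ (hin p.1 hp.1)
    simpa using this
  have hlim : ∀ l, ∃ y, Tendsto (fun N => s N l) atTop (𝓝 y) := fun l =>
    cauchySeq_tendsto_of_complete (hunif.cauchySeq (Set.mem_univ l))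
  choose h hh using hlim
  refine ⟨h, ?_, fun l => ?_, hh⟩
  · have h1 : TendstoUniformly s h atTop := by
      rw [← tendstoUniformlyOn_univ]
      exact hunif.tendstoUniformlyOn_of_tendsto fun l _ => hh l
    refine h1.continuous (Frequently.of_forall fun N => ?_)
    exact continuous_finsetSum _ fun j _ => (hg j).comp (continuous_apply j)
  · refine hWW (hW'c.mem_of_tendsto (hh l) (Eventually.of_forall fun N => hk ?_))
    have := key l N 0
    simpa [hs] using this

/-! ### The Kuratowski–Ulam theorem -/

/-- Almost all sections of a meagre subset of a product are meagre. -/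
theorem IsMeagre.eventually_isMeagre_section {X Y : Type*} [TopologicalSpace X]
    [TopologicalSpace Y] [SecondCountableTopology X] {A : Set (X × Y)} (hA : IsMeagre A) :
    ∀ᶠ y in residual Y, IsMeagre {x | (x, y) ∈ A} := by
  suffices H : ∀ U : Set (X × Y), IsOpen U → Dense U →
      ∀ᶠ y in residual Y, {x | (x, y) ∈ U} ∈ residual X by
    obtain ⟨S, hSo, hSd, hSc, hSA⟩ := mem_residual_iff.1 hA
    have : ∀ᶠ y in residual Y, ∀ U ∈ S, {x | (x, y) ∈ U} ∈ residual X :=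
      (eventually_countable_ball hSc).2 fun U hU => H U (hSo U hU) (hSd U hU)
    filter_upwards [this] with y hy
    refine mem_of_superset ((countable_bInter_mem hSc).2 hy) fun x hx => ?_
    exact hSA fun U hU => (Set.mem_iInter₂.1 hx U hU)
  intro U hU hd
  -- The section at `y` is open, so its density need only be tested on countably many sets `O`; for
  -- each, the good `y` form a dense open set.
  have : ∀ᶠ y in residual Y, ∀ O ∈ countableBasis X, ∃ x ∈ O, (x, y) ∈ U := by
    refine (eventually_countable_ball (countable_countableBasis X)).2 fun O hO => ?_
    have hOo := isOpen_of_mem_countableBasis hO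
    have himg : {y | ∃ x ∈ O, (x, y) ∈ U} = Prod.snd '' (U ∩ (O ×ˢ Set.univ)) := by
      ext y
      simp only [Set.mem_ofPred_eq, Set.mem_image, Set.mem_inter_iff, Set.mem_prod, Set.mem_univ,
        and_true, Prod.exists, exists_eq_right]
      exact exists_congr fun x => and_comm
    refine residual_of_dense_open (s := {y | ∃ x ∈ O, (x, y) ∈ U}) ?_ ?_
    · rw [himg]
      exact isOpenMap_snd _ (hU.inter (hOo.prod isOpen_univ))
    · refine dense_iff_inter_open.2 fun V hV hVne => ?_
      obtain ⟨p, hp, hpU⟩ := hd.inter_open_nonempty (O ×ˢ V) (hOo.prod hV)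
        ((nonempty_of_mem_countableBasis hO).prod hVne)
      exact ⟨p.2, hp.2, p.1, hp.1, hpU⟩
  filter_upwards [this] with y hy
  refine residual_of_dense_open (hU.preimage (Continuous.prodMk_left y)) ?_
  refine (isBasis_countableBasis X).dense_iff.2 fun O hO _ => ?_
  obtain ⟨x, hx, hxU⟩ := hy O hO
  exact ⟨x, hx, hxU⟩

/-- A Baire measurable subset of a product all of whose sections are meagre is meagre. -/
theorem isMeagre_of_forall_isMeagre_section {X Y : Type*} [TopologicalSpace X]
    [TopologicalSpace Y] [SecondCountableTopology X] [BaireSpace X] [BaireSpace Y]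
    {A : Set (X × Y)} (hA : BaireMeasurableSet A) (h : ∀ y, IsMeagre {x | (x, y) ∈ A}) :
    IsMeagre A := by
  obtain ⟨U, hU, hAU⟩ := hA.residualEq_isOpen
  rcases U.eq_empty_or_nonempty with rfl | ⟨p, hp⟩
  · filter_upwards [hAU] with q hq hqA
    exact (hq.mp hqA : q ∈ (∅ : Set (X × Y)))
  · exfalso
    -- For generic `y ∈ V`, the nonempty open set `O` is covered by the sections at `y` of `A` and
    -- of its difference from `U`, both meagre.
    obtain ⟨O, V, hO, hV, hpO, hpV, hOV⟩ := isOpen_prod_iff.1 hU p.1 p.2 hp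
    have hm : IsMeagre {q : X × Y | ¬ (q ∈ A ↔ q ∈ U)} := by
      refine mem_of_superset hAU fun q hq => ?_
      exact not_not.2 (Iff.of_eq hq)
    obtain ⟨y, hy, hyV⟩ := (dense_of_mem_residual hm.eventually_isMeagre_section).exists_mem_open
      hV ⟨p.2, hpV⟩
    refine not_isMeagre_of_isOpen hO ⟨p.1, hpO⟩ (((h y).union hy).mono fun x hx => ?_)
    have hxU : (x, y) ∈ U := hOV (Set.mk_mem_prod hx hyV)
    by_cases hxA : (x, y) ∈ A
    · exact Or.inl hxA
    · exact Or.inr fun hiff => hxA (hiff.2 hxU)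

/-! ### Haar meager sets -/

/-- A Haar meager set has witnesses with arbitrarily small values, if one allows Polish spaces as
the domain of a witness. -/
theorem IsHaarMeager.exists_small_witness {X : Type*} [AddCommGroup X] [TopologicalSpace X]
    [IsTopologicalAddGroup X] {A : Set X} (hA : IsHaarMeager A) {V : Set X}
    (hV : V ∈ 𝓝 (0 : X)) :
    ∃ B : Set X, @MeasurableSet X (borel X) B ∧ A ⊆ B ∧
      ∃ (L : Type) (_ : TopologicalSpace L) (_ : PolishSpace L) (_ : Nonempty L) (g : L → X),
        Continuous g ∧ (∀ t, g t ∈ V) ∧ ∀ x, IsMeagre {t | g t + x ∈ B} := by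
  obtain ⟨B, hB, hAB, K, _, _, ⟨t₀⟩, g, hg, hm⟩ := hA
  -- The witness is translated to vanish at `t₀` and restricted to an open set, at the price of
  -- compactness: an open subset is only Polish.
  have hU : IsOpen {t | g t - g t₀ ∈ interior V} :=
    isOpen_interior.preimage (hg.sub continuous_const)
  refine ⟨B, hB, hAB, {t | g t - g t₀ ∈ interior V}, inferInstance, hU.polishSpace,
    ⟨⟨t₀, by simpa using mem_interior_iff_mem_nhds.2 hV⟩⟩, fun t => g t - g t₀,
    (hg.comp continuous_subtype_val).sub continuous_const, fun t => interior_subset t.2,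
    fun x => ?_⟩
  refine ((hm (g t₀ - x)).preimage_of_isOpenMap continuous_subtype_val
    hU.isOpenMap_subtype_val).mono fun t ht => ?_
  refine ⟨_, ht, ?_⟩
  simp only
  abel

/-- Given a continuous map `g` from a Polish space and countably many Haar meager sets, some
arbitrarily small translate of `g` meets each of these sets in a meagre set of parameters. -/
theorem exists_mem_nhds_forall_isMeagre_preimage {X : Type*} [AddCommGroup X] [TopologicalSpace X]
    [IsTopologicalAddGroup X] [IsCompletelyMetrizableSpace X] {T : ℕ → Set X}
    (hT : ∀ p, IsHaarMeager (T p)) {K : Type*} [TopologicalSpace K] [PolishSpace K] {g : K → X}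
    (hg : Continuous g) {W : Set X} (hW : W ∈ 𝓝 (0 : X)) :
    ∃ z ∈ W, ∀ p, IsMeagre {k | g k + z ∈ T p} := by
  obtain ⟨V, hV, hsum⟩ := exists_nhds_zero_forall_continuous_sum hW
  choose B hB hTB L topL polL neL w hw hwV hwm using fun p => (hT p).exists_small_witness (hV p)
  obtain ⟨h, hh, hhW, hlim⟩ := hsum L w hw hwV
  have hdiff : ∀ p (l l' : ∀ j, L j), (∀ j, j ≠ p → l j = l' j) →
      h l - h l' = w p (l p) - w p (l' p) := by
    intro p l l' hll
    refine tendsto_nhds_unique ((hlim l).sub (hlim l')) (tendsto_const_nhds.congr' ?_)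
    filter_upwards [Ioi_mem_atTop p] with N hN
    rw [← Finset.sum_sub_distrib, Finset.sum_eq_single p]
    · intro j _ hj
      rw [hll j hj, sub_self]
    · exact fun hp => absurd (Finset.mem_range.2 hN) hp
  -- With `k` and all coordinates of `l` except the `p`-th fixed, `h` is a translate of the witness
  -- `w p`, so every section is meagre.
  have hmeagre : ∀ p, IsMeagre {q : K × (∀ j, L j) | g q.1 + h q.2 ∈ B p} := by
    intro p
    let Φ : L p × ((∀ j : {j // j ≠ p}, L j) × K) ≃ₜ K × (∀ j, L j) :=
      ((Homeomorph.prodAssoc _ _ _).symm.trans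
        ((Homeomorph.piSplitAt p L).symm.prodCongr (Homeomorph.refl K))).trans
        (Homeomorph.prodComm _ _)
    have hF : Continuous fun q : K × (∀ j, L j) => g q.1 + h q.2 :=
      (hg.comp continuous_fst).add (hh.comp continuous_snd)
    suffices hs : IsMeagre (Φ ⁻¹' {q | g q.1 + h q.2 ∈ B p}) by
      have := hs.preimage_of_isOpenMap Φ.symm.continuous Φ.symm.isOpenMap
      rwa [← Set.preimage_comp, Φ.self_comp_symm, Set.preimage_id] at this
    refine isMeagre_of_forall_isMeagre_section ?_ fun r => ?_
    · borelize X (L p × ((∀ j : {j // j ≠ p}, L j) × K))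
      exact ((hF.comp Φ.continuous).measurable (hB p)).baireMeasurableSet
    · obtain ⟨t₀⟩ := neL p
      let l : L p → ∀ j, L j := fun t => (Homeomorph.piSplitAt p L).symm (t, r.1)
      have hlp : ∀ t, l t p = t := fun t => by simp [l]
      refine (hwm p (g r.2 + h (l t₀) - w p t₀)).mono fun t ht => ?_
      have h1 : h (l t) - h (l t₀) = w p t - w p t₀ := by
        rw [hdiff p (l t) (l t₀) fun j hj => by simp [l, hj], hlp, hlp]
      have h2 : g r.2 + h (l t) ∈ B p := ht
      have h3 : w p t + (g r.2 + h (l t₀) - w p t₀) = g r.2 + h (l t) := by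
        rw [← sub_eq_zero] at h1 ⊢
        rw [← neg_eq_zero, ← h1]
        abel
      exact (congrArg (· ∈ B p) h3).mpr h2
  have hev : ∀ᶠ l in residual (∀ j, L j), ∀ p, IsMeagre {k | g k + h l ∈ B p} :=
    eventually_countable_forall.2 fun p => (hmeagre p).eventually_isMeagre_section
  obtain ⟨l, hl⟩ := (dense_of_mem_residual hev).nonempty
  exact ⟨h l, hhW l, fun p => (hl p).mono fun k hk => hTB p hk⟩

/-- The preimage of a Haar meager set under an affine homeomorphism is Haar meager. -/
theorem IsHaarMeager.preimage_add_smul {X : Type*} [AddCommGroup X] [Module ℝ X]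
    [TopologicalSpace X] [IsTopologicalAddGroup X] [ContinuousSMul ℝ X] {A : Set X}
    (hA : IsHaarMeager A) (a : X) {c : ℝ} (hc : c ≠ 0) :
    IsHaarMeager {u | a + c • u ∈ A} := by
  obtain ⟨B, hB, hAB, K, hK, hK', hK'', g, hg, hm⟩ := hA
  refine ⟨{u | a + c • u ∈ B}, ?_, fun u hu => hAB hu, K, hK, hK', hK'', fun k => c⁻¹ • g k,
    hg.const_smul _, fun x => ?_⟩
  · borelize X
    have : Continuous fun u : X => a + c • u := by fun_prop
    exact this.measurable hB
  · refine (hm (c • x - a)).mono ?_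
    rintro k ⟨u, hu, huk⟩
    refine ⟨_, hu, ?_⟩
    have : g k = c • (u + x) := by
      simp only at huk
      rw [huk, smul_inv_smul₀ hc]
    simp only [this, smul_add]
    abel

/-! ### Coordinate changes in nonmeagre sets of sequences -/

/-- Openness holds because `{e}` is open in a discrete space; it lets residual sets be pulled back
along a change of one coordinate. -/
theorem isOpenMap_update_const {E : Type*} [TopologicalSpace E] [DiscreteTopology E] (k : ℕ)
    (e : E) : IsOpenMap fun ε : ℕ → E => Function.update ε k e := by
  let Φ := Homeomorph.piSplitAt k (fun _ : ℕ => E)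
  have h : (fun ε : ℕ → E => Function.update ε k e) =
      Φ.symm ∘ Prod.map (fun _ => e) id ∘ Φ := by
    funext ε j
    by_cases hj : j = k
    · subst hj; simp [Φ]
    · simp [Φ, hj]
  have hc : IsOpenMap fun _ : E => e := fun s _ => isOpen_discrete _
  rw [h]
  exact Φ.symm.isOpenMap.comp ((hc.prodMap IsOpenMap.id).comp Φ.isOpenMap)

/-- In a nonmeagre Baire measurable set of sequences over a finite alphabet, for all large `k`
there is a sequence whose `k`-th term may be changed arbitrarily. -/
theorem exists_forall_update_mem_of_not_isMeagre {E : Type*} [TopologicalSpace E]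
    [DiscreteTopology E] [Finite E] {B : Set (ℕ → E)} (hB : BaireMeasurableSet B)
    (hB' : ¬ IsMeagre B) :
    ∃ k₀, ∀ k ≥ k₀, ∃ ε : ℕ → E, ∀ e, Function.update ε k e ∈ B := by
  obtain ⟨U, hU, hBU⟩ := hB.residualEq_isOpen
  have hne : U.Nonempty := by
    rw [Set.nonempty_iff_ne_empty]
    rintro rfl
    refine hB' ?_
    filter_upwards [hBU] with q hq hqB
    exact (hq.mp hqB : q ∈ (∅ : Set (ℕ → E)))
  obtain ⟨ε₀, hε₀⟩ := hne
  obtain ⟨I, u, hu, hIU⟩ := isOpen_pi_iff.1 hU ε₀ hε₀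
  -- The cylinder inside `U` constrains only coordinates below `k₀`, so later changes never leave
  -- it.
  obtain ⟨k₀, hk₀⟩ := I.exists_nat_subset_range
  refine ⟨k₀, fun k hk => ?_⟩
  have hev : ∀ᶠ ε in residual (ℕ → E), ∀ e, (Function.update ε k e ∈ B ↔
      Function.update ε k e ∈ U) :=
    eventually_countable_forall.2 fun e =>
      (tendsto_residual_of_isOpenMap (continuous_id.update k continuous_const)
        (isOpenMap_update_const k e)).eventually (hBU.mono fun q hq => Iff.of_eq hq)
  obtain ⟨ε, hε, hεI⟩ := (dense_of_mem_residual hev).exists_mem_open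
    (isOpen_set_pi I.finite_toSet fun j hj => (hu j hj).1) ⟨ε₀, fun j hj => (hu j hj).2⟩
  refine ⟨ε, fun e => (hε e).2 (hIU fun j hj => ?_)⟩
  have : j ≠ k := ((Finset.mem_range.1 (hk₀ hj)).trans_le hk).ne
  rw [Function.update_of_ne this]
  exact hεI j hj

/-! ### Iterated differences of locally bounded functions -/

theorem fwdDiff_iter_succ_apply {X Y : Type*} [AddCommGroup X] [AddCommGroup Y] (F : X → Y)
    (r : ℕ) (x h : X) :
    (fwdDiff h)^[r + 1] F x = (fwdDiff h)^[r] F (x + h) - (fwdDiff h)^[r] F x := by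
  rw [Function.iterate_succ_apply']
  rfl

theorem sum_fwdDiff_iter_succ {X Y : Type*} [AddCommGroup X] [AddCommGroup Y] (F : X → Y)
    (r m : ℕ) (x h : X) :
    ∑ i ∈ Finset.range m, (fwdDiff h)^[r + 1] F (x + i • h) =
      (fwdDiff h)^[r] F (x + m • h) - (fwdDiff h)^[r] F x := by
  have := Finset.sum_range_sub (fun i : ℕ => (fwdDiff h)^[r] F (x + i • h)) m
  simp only [zero_smul, add_zero] at this
  rw [← this]
  refine Finset.sum_congr rfl fun i _ => ?_
  rw [fwdDiff_iter_succ_apply, succ_nsmul, add_assoc]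

/-- Reversing a progression changes a difference only by a sign, so estimates for directions in `S`
carry over to `-S`. -/
theorem fwdDiff_iter_neg {X Y : Type*} [AddCommGroup X] [AddCommGroup Y] (F : X → Y)
    (r : ℕ) (x h : X) :
    (fwdDiff (-h))^[r] F (x + r • h) = (-1 : ℤ) ^ r • (fwdDiff h)^[r] F x := by
  induction r generalizing x with
  | zero => simp
  | succ r ih =>
    rw [fwdDiff_iter_succ_apply, fwdDiff_iter_succ_apply]
    have h1 : x + (r + 1) • h + -h = x + r • h := by rw [succ_nsmul]; abel
    have h2 : x + (r + 1) • h = x + h + r • h := by rw [succ_nsmul]; abel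
    rw [h1, h2, ih, ih, pow_succ, mul_neg_one, neg_smul, smul_sub]
    abel

theorem norm_nsmul_eq_natCast_mul {Y : Type*} [NormedAddCommGroup Y] [NormedSpace ℝ Y] (m : ℕ)
    (y : Y) : ‖m • y‖ = m * ‖y‖ := by
  rw [← Nat.cast_smul_eq_nsmul ℝ, norm_smul, Real.norm_natCast]

theorem tendsto_add_zsmul_prod {X : Type*} [AddCommGroup X] [TopologicalSpace X]
    [IsTopologicalAddGroup X] (x₀ : X) (i : ℤ) :
    Tendsto (fun p : X × X => (p.1 + i • p.2, p.2)) (𝓝 (x₀, 0)) (𝓝 (x₀, 0)) := by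
  have : Continuous fun p : X × X => (p.1 + i • p.2, p.2) := by fun_prop
  simpa using this.tendsto (x₀, 0)

theorem eventually_forall_add_zsmul {X : Type*} [AddCommGroup X] [TopologicalSpace X]
    [IsTopologicalAddGroup X] {x₀ : X} {P : X × X → Prop} (hP : ∀ᶠ p in 𝓝 (x₀, (0 : X)), P p)
    (m : ℕ) : ∀ᶠ p in 𝓝 (x₀, (0 : X)), ∀ i ∈ Finset.Icc (-(m : ℤ)) m, P (p.1 + i • p.2, p.2) :=
  (Finset.eventually_all _).2 fun i _ => (tendsto_add_zsmul_prod x₀ i).eventually hP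

section

variable {X Y : Type*} [AddCommGroup X] [TopologicalSpace X] [IsTopologicalAddGroup X]
  [NormedAddCommGroup Y]

theorem eventually_norm_fwdDiff_iter_le {F : X → Y} {x₀ : X} {C : ℝ}
    (hF : ∀ᶠ x in 𝓝 x₀, ‖F x‖ ≤ C) (r : ℕ) :
    ∀ᶠ p in 𝓝 (x₀, (0 : X)), ‖(fwdDiff p.2)^[r] F p.1‖ ≤ 2 ^ r * C := by
  induction r with
  | zero =>
    have : Tendsto Prod.fst (𝓝 (x₀, (0 : X))) (𝓝 x₀) := continuous_fst.tendsto _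
    simpa using this.eventually hF
  | succ r ih =>
    filter_upwards [ih, (tendsto_add_zsmul_prod x₀ 1).eventually ih] with p h1 h2
    rw [fwdDiff_iter_succ_apply]
    rw [one_smul] at h2
    calc _ ≤ _ := norm_sub_le _ _
      _ ≤ 2 ^ r * C + 2 ^ r * C := add_le_add h2 h1
      _ = _ := by ring

/-- If the differences of order `r + 2` tend to zero, so do those of order `r + 1`. -/
theorem eventually_norm_fwdDiff_iter_le_of_succ [NormedSpace ℝ Y] {F : X → Y} {x₀ : X} {C : ℝ}
    (hF : ∀ᶠ x in 𝓝 x₀, ‖F x‖ ≤ C) (r : ℕ)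
    (h : ∀ ε > 0, ∀ᶠ p in 𝓝 (x₀, (0 : X)), ‖(fwdDiff p.2)^[r + 2] F p.1‖ ≤ ε) :
    ∀ ε > 0, ∀ᶠ p in 𝓝 (x₀, (0 : X)), ‖(fwdDiff p.2)^[r + 1] F p.1‖ ≤ ε := by
  intro ε hε
  -- The sum of `m` consecutive differences telescopes to at most `2 ^ (r + 1) * C`. Once `m` makes
  -- this at most `m * (ε / 2)`, order `r + 2` is made so small that the summands differ from the
  -- first by at most `ε / 2`.
  obtain ⟨m, hm⟩ := exists_nat_gt (max 0 (2 ^ (r + 1) * C / (ε / 2)))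
  have hm0 : (0 : ℝ) < m := (le_max_left _ _).trans_lt hm
  have hmC : 2 ^ (r + 1) * C ≤ m * (ε / 2) :=
    ((div_lt_iff₀ (half_pos hε)).1 ((le_max_right _ _).trans_lt hm)).le
  filter_upwards [eventually_forall_add_zsmul (h (ε / (2 * m)) (by positivity)) m,
    eventually_forall_add_zsmul (eventually_norm_fwdDiff_iter_le hF r) m] with p h1 h2
  set c : ℕ → Y := fun i => (fwdDiff p.2)^[r + 1] F (p.1 + i • p.2) with hc
  have hstep : ∀ i < m, ‖c (i + 1) - c i‖ ≤ ε / (2 * m) := by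
    intro i hi
    have := h1 i (Finset.mem_Icc.2 ⟨by omega, by omega⟩)
    simp only [natCast_zsmul] at this
    rwa [fwdDiff_iter_succ_apply, add_assoc, ← succ_nsmul] at this
  have hdist : ∀ i ≤ m, ‖c i - c 0‖ ≤ i * (ε / (2 * m)) := by
    intro i
    induction i with
    | zero => simp
    | succ i ih =>
      intro hi
      have h3 : c (i + 1) - c 0 = (c (i + 1) - c i) + (c i - c 0) := by abel
      rw [h3]
      refine (norm_add_le _ _).trans ?_
      push_cast
      linarith [hstep i hi, ih (by omega)]
  have hsum : ‖∑ i ∈ Finset.range m, c i‖ ≤ 2 ^ (r + 1) * C := by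
    rw [hc, sum_fwdDiff_iter_succ]
    have h3 := h2 m (Finset.mem_Icc.2 ⟨by omega, by omega⟩)
    have h4 := h2 0 (Finset.mem_Icc.2 ⟨by omega, by omega⟩)
    simp only [natCast_zsmul, zero_smul, add_zero] at h3 h4
    calc _ ≤ _ := norm_sub_le _ _
      _ ≤ 2 ^ r * C + 2 ^ r * C := add_le_add h3 h4
      _ = _ := by ring
  have hsum' : ‖∑ i ∈ Finset.range m, (c i - c 0)‖ ≤ m * (ε / 2) := by
    refine (norm_sum_le_of_le _ (f := fun i => c i - c 0) (n := fun _ => ε / 2)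
      fun i hi => ?_).trans_eq (by simp)
    have hi' := Finset.mem_range.1 hi
    refine (hdist i hi'.le).trans ?_
    have : (i : ℝ) ≤ m := by exact_mod_cast hi'.le
    calc (i : ℝ) * (ε / (2 * m)) ≤ m * (ε / (2 * m)) := by gcongr
      _ = ε / 2 := by field_simp
  have heq : m • c 0 = ∑ i ∈ Finset.range m, c i - ∑ i ∈ Finset.range m, (c i - c 0) := by
    simp
  have hn : m * ‖c 0‖ ≤ m * ε := by
    rw [← norm_nsmul_eq_natCast_mul, heq]
    calc _ ≤ _ := norm_sub_le _ _
      _ ≤ m * (ε / 2) + m * (ε / 2) := add_le_add (hsum.trans hmC) hsum'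
      _ = _ := by ring
  have := le_of_mul_le_mul_left hn hm0
  simpa [hc] using this

variable [PartialOrder Y] [IsOrderedAddMonoid Y]

/-- In an ordered normed group with monotone norm, an element between `a` and `b` has norm at most
`‖a‖ + ‖b - a‖`. -/
theorem norm_le_of_mem_Icc (hnorm : ∀ x y : Y, 0 ≤ x → x ≤ y → ‖x‖ ≤ ‖y‖) {a b c : Y}
    (hac : a ≤ c) (hcb : c ≤ b) : ‖c‖ ≤ ‖a‖ + ‖b - a‖ := by
  have h := hnorm (c - a) (b - a) (sub_nonneg.2 hac) (sub_le_sub_right hcb a)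
  have h2 := norm_add_le a (c - a)
  rw [add_sub_cancel] at h2
  linarith

/-- If the differences of order `k + 2` in the directions of `S` are nonnegative, the differences of
order `k + 1` tend to zero in these directions. -/
theorem eventually_norm_fwdDiff_iter_le_of_nonneg [NormedSpace ℝ Y]
    (hnorm : ∀ x y : Y, 0 ≤ x → x ≤ y → ‖x‖ ≤ ‖y‖) {F : X → Y} {x₀ : X} {C : ℝ}
    (hF : ∀ᶠ x in 𝓝 x₀, ‖F x‖ ≤ C) {S : Set X} (k : ℕ)
    (h : ∀ᶠ p in 𝓝 (x₀, (0 : X)), p.2 ∈ S → 0 ≤ (fwdDiff p.2)^[k + 2] F p.1) :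
    ∀ ε > 0, ∀ᶠ p in 𝓝 (x₀, (0 : X)), p.2 ∈ S → ‖(fwdDiff p.2)^[k + 1] F p.1‖ ≤ ε := by
  intro ε hε
  -- By monotonicity `m • c 0` lies between the sums of `c` over `[-m, 0)` and `[0, m)`. Each
  -- telescopes to norm at most `2 ^ (k + 1) * C`; `norm_le_of_mem_Icc` uses the lower sum and the
  -- difference of both, hence the factor 3.
  obtain ⟨m, hm⟩ := exists_nat_gt (max 0 (3 * (2 ^ (k + 1) * C) / ε))
  have hm0 : (0 : ℝ) < m := (le_max_left _ _).trans_lt hm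
  have hmC : 3 * (2 ^ (k + 1) * C) ≤ m * ε :=
    ((div_lt_iff₀ hε).1 ((le_max_right _ _).trans_lt hm)).le
  filter_upwards [eventually_forall_add_zsmul h m,
    eventually_forall_add_zsmul (eventually_norm_fwdDiff_iter_le hF k) m] with p h1 h2 hp
  set c : ℤ → Y := fun i => (fwdDiff p.2)^[k + 1] F (p.1 + i • p.2) with hc
  have hstep : ∀ i ∈ Finset.Icc (-(m : ℤ)) m, c i ≤ c (i + 1) := by
    intro i hi
    have := h1 i hi hp
    rw [fwdDiff_iter_succ_apply, sub_nonneg, add_assoc, ← add_one_zsmul] at this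
    exact this
  have hup : ∀ i : ℕ, i ≤ m → c 0 ≤ c i := by
    intro i
    induction i with
    | zero => simp
    | succ i ih =>
      intro hi
      refine (ih (by omega)).trans ?_
      push_cast
      exact hstep i (Finset.mem_Icc.2 ⟨by omega, by omega⟩)
  have hdown : ∀ i : ℕ, i ≤ m → c (-i) ≤ c 0 := by
    intro i
    induction i with
    | zero => simp
    | succ i ih =>
      intro hi
      refine le_trans ?_ (ih (by omega))
      have := hstep (-(i + 1 : ℕ)) (Finset.mem_Icc.2 ⟨by omega, by omega⟩)
      rwa [show -((i + 1 : ℕ) : ℤ) + 1 = -(i : ℤ) by push_cast; ring] at this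
  have hd : ∀ i ∈ Finset.Icc (-(m : ℤ)) m, ‖(fwdDiff p.2)^[k] F (p.1 + i • p.2)‖ ≤ 2 ^ k * C := h2
  have hsub : ∀ i ∈ Finset.Icc (-(m : ℤ)) m, ∀ j ∈ Finset.Icc (-(m : ℤ)) m,
      ‖(fwdDiff p.2)^[k] F (p.1 + i • p.2) - (fwdDiff p.2)^[k] F (p.1 + j • p.2)‖ ≤
        2 ^ (k + 1) * C := fun i hi j hj =>
    calc _ ≤ _ := norm_sub_le _ _
      _ ≤ 2 ^ k * C + 2 ^ k * C := add_le_add (hd i hi) (hd j hj)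
      _ = _ := by ring
  have hU : ∑ i ∈ Finset.range m, c i =
      (fwdDiff p.2)^[k] F (p.1 + (m : ℤ) • p.2) -
        (fwdDiff p.2)^[k] F (p.1 + (0 : ℤ) • p.2) := by
    have := sum_fwdDiff_iter_succ F k m p.1 p.2
    simpa [hc] using this
  have hL : ∑ i ∈ Finset.range m, c (-(m : ℤ) + i) =
      (fwdDiff p.2)^[k] F (p.1 + (0 : ℤ) • p.2) -
        (fwdDiff p.2)^[k] F (p.1 + (-(m : ℤ)) • p.2) := by
    have := sum_fwdDiff_iter_succ F k m (p.1 + (-(m : ℤ)) • p.2) p.2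
    have h0 : p.1 + (-(m : ℤ)) • p.2 + m • p.2 = p.1 + (0 : ℤ) • p.2 := by simp
    rw [h0] at this
    rw [← this]
    refine Finset.sum_congr rfl fun i _ => ?_
    rw [hc]
    simp only [add_smul, natCast_zsmul, add_assoc]
  have h0m : (0 : ℤ) ∈ Finset.Icc (-(m : ℤ)) m := Finset.mem_Icc.2 ⟨by omega, by omega⟩
  have hmm : (m : ℤ) ∈ Finset.Icc (-(m : ℤ)) m := Finset.mem_Icc.2 ⟨by omega, by omega⟩
  have hnm : -(m : ℤ) ∈ Finset.Icc (-(m : ℤ)) m := Finset.mem_Icc.2 ⟨by omega, by omega⟩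
  have hle : ∑ i ∈ Finset.range m, c (-(m : ℤ) + i) ≤ m • c 0 := by
    have := Finset.sum_le_card_nsmul (Finset.range m) (fun i : ℕ => c (-(m : ℤ) + i)) (c 0)
      fun i hi => by
        have hi' := Finset.mem_range.1 hi
        have := hdown (m - i) (by omega)
        rwa [show -((m - i : ℕ) : ℤ) = -(m : ℤ) + i by omega] at this
    simpa using this
  have hge : m • c 0 ≤ ∑ i ∈ Finset.range m, c i := by
    have := Finset.card_nsmul_le_sum (Finset.range m) (fun i : ℕ => c i) (c 0)
      fun i hi => hup i (Finset.mem_range.1 hi).le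
    simpa using this
  have hn : m * ‖c 0‖ ≤ m * ε := by
    rw [← norm_nsmul_eq_natCast_mul]
    refine (norm_le_of_mem_Icc hnorm hle hge).trans ?_
    have h3 := norm_sub_le (∑ i ∈ Finset.range m, c i) (∑ i ∈ Finset.range m, c (-(m : ℤ) + i))
    have h4 := hsub _ hmm _ h0m
    have h5 := hsub _ h0m _ hnm
    rw [← hU] at h4
    rw [← hL] at h5
    linarith
  have := le_of_mul_le_mul_left hn hm0
  simpa [hc] using this

/-- A locally bounded function whose differences of order `n + 1 ≥ 2` are nonnegative in
the directions of `S`, where `S ∪ -S ∪ {0}` is the whole space, is continuous. -/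
theorem continuousAt_of_eventually_norm_le_of_fwdDiff_iter_nonneg [NormedSpace ℝ Y]
    (hnorm : ∀ x y : Y, 0 ≤ x → x ≤ y → ‖x‖ ≤ ‖y‖) {F : X → Y} {x₀ : X} {C : ℝ}
    (hF : ∀ᶠ x in 𝓝 x₀, ‖F x‖ ≤ C) {S : Set X} (hS : S ∪ (-S) ∪ {0} = Set.univ) {n : ℕ}
    (hn : 1 ≤ n)
    (h : ∀ᶠ p in 𝓝 (x₀, (0 : X)), p.2 ∈ S → 0 ≤ (fwdDiff p.2)^[n + 1] F p.1) :
    ContinuousAt F x₀ := by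
  obtain ⟨k, rfl⟩ := Nat.exists_eq_add_of_le' hn
  have htop : ∀ ε > 0, ∀ᶠ p in 𝓝 (x₀, (0 : X)), ‖(fwdDiff p.2)^[k + 1] F p.1‖ ≤ ε := by
    intro ε hε
    have h1 := eventually_norm_fwdDiff_iter_le_of_nonneg hnorm hF k h ε hε
    have ht : Tendsto (fun p : X × X => (p.1 + (k + 1) • p.2, -p.2)) (𝓝 (x₀, 0))
        (𝓝 (x₀, 0)) := by
      have : Continuous fun p : X × X => (p.1 + (k + 1) • p.2, -p.2) := by fun_prop
      simpa using this.tendsto (x₀, 0)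
    filter_upwards [h1, ht.eventually h1] with p hp hp'
    have hmem : p.2 ∈ S ∪ (-S) ∪ {0} := hS ▸ Set.mem_univ _
    rcases hmem with (hmem | hmem) | hmem
    · exact hp hmem
    · have h2 := hp' hmem
      rw [fwdDiff_iter_neg] at h2
      rcases neg_one_pow_eq_or ℤ (k + 1) with h3 | h3 <;> simpa [h3] using h2
    · rw [Set.mem_singleton_iff] at hmem
      rw [fwdDiff_iter_succ_apply, hmem]
      simpa using hε.le
  have hone : ∀ ε > 0, ∀ᶠ p in 𝓝 (x₀, (0 : X)), ‖(fwdDiff p.2)^[1] F p.1‖ ≤ ε := by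
    clear h hn
    induction k with
    | zero => exact htop
    | succ k ih => exact ih (eventually_norm_fwdDiff_iter_le_of_succ hF k htop)
  rw [ContinuousAt, Metric.tendsto_nhds]
  intro ε hε
  have ht : Tendsto (fun x : X => (x₀, x - x₀)) (𝓝 x₀) (𝓝 (x₀, 0)) := by
    have : Continuous fun x : X => (x₀, x - x₀) := by fun_prop
    simpa using this.tendsto x₀
  filter_upwards [ht.eventually (hone (ε / 2) (half_pos hε))] with x hx
  rw [dist_eq_norm]
  simp only [Function.iterate_one, fwdDiff, add_sub_cancel] at hx
  linarith

end

/-! ### Local boundedness of measurable `n`-convex functions -/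

/-- The definition of `n`-convexity in terms of the iterated differences of an extension. -/
theorem IsNConvexWRT.fwdDiff_iter_nonneg {X Y : Type*} [AddCommGroup X] [Module ℝ X]
    [NormedAddCommGroup Y] [NormedSpace ℝ Y] [PartialOrder Y] {n : ℕ} {S D : Set X} {f : D → Y}
    (hf : IsNConvexWRT n S f) {x h : X} (hh : h ∈ S) (hx : ∀ j ≤ n + 1, x + j • h ∈ D) :
    0 ≤ (fwdDiff h)^[n + 1] (Function.extend Subtype.val f 0) x := by
  have hx' : ∀ j : Fin (n + 2), x + ((j : ℕ) : ℝ) • h ∈ D := fun j => by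
    rw [Nat.cast_smul_eq_nsmul]
    exact hx j (by omega)
  refine (hf x h hh hx').trans_eq ?_
  rw [fwdDiff_iter_eq_sum_shift, Finset.sum_range]
  refine Finset.sum_congr rfl fun j _ => ?_
  have h1 := Subtype.val_injective.extend_apply f 0 ⟨_, hx' j⟩
  rw [← h1, ← Int.cast_smul_eq_zsmul ℝ]
  simp only [Nat.cast_smul_eq_nsmul]
  push_cast
  rfl

section

variable {X Y : Type*} [AddCommGroup X] [NormedAddCommGroup Y] [NormedSpace ℝ Y] [PartialOrder Y]

/-- Isolating one term in a nonnegative iterated difference. -/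
theorem exists_norm_le_of_fwdDiff_iter_nonneg {F : X → Y} {N i : ℕ} (hi : i ≤ N) {x d : X}
    (h : 0 ≤ (fwdDiff d)^[N] F x) {m : ℝ} (hm : ∀ j ≤ N, j ≠ i → ‖F (x + j • d)‖ ≤ m) :
    ∃ R : Y, ‖R‖ ≤ (N + 1) * (2 ^ N * |m|) ∧
      0 ≤ ((-1 : ℤ) ^ (N - i) * N.choose i) • F (x + i • d) + R := by
  rw [fwdDiff_iter_eq_sum_shift,
    ← Finset.add_sum_erase _ _ (Finset.mem_range.2 (Nat.lt_succ_of_le hi))] at h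
  refine ⟨_, ?_, h⟩
  refine (norm_sum_le_of_le _ (n := fun _ => 2 ^ N * |m|) fun j hj => ?_).trans ?_
  · rw [Finset.mem_erase, Finset.mem_range] at hj
    rw [← Int.cast_smul_eq_zsmul ℝ, norm_smul]
    have h1 : ‖(((-1 : ℤ) ^ (N - j) * (N.choose j : ℤ) : ℤ) : ℝ)‖ ≤ 2 ^ N := by
      push_cast
      rw [norm_mul, norm_pow, norm_neg, norm_one, one_pow, one_mul, Real.norm_natCast]
      exact_mod_cast Nat.choose_le_two_pow N j
    exact mul_le_mul h1 ((hm j (by omega) hj.1).trans (le_abs_self m)) (norm_nonneg _)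
      (by positivity)
  · rw [Finset.sum_const, nsmul_eq_mul]
    have : ((Finset.range (N + 1)).erase i).card ≤ N + 1 := by
      simpa using Finset.card_erase_le (s := Finset.range (N + 1)) (a := i)
    gcongr
    exact_mod_cast this

variable [IsOrderedAddMonoid Y]

/-- Two nonnegative iterated differences bound the function at a point. -/
theorem norm_le_of_fwdDiff_iter_nonneg (hnorm : ∀ x y : Y, 0 ≤ x → x ≤ y → ‖x‖ ≤ ‖y‖) {F : X → Y}
    {n : ℕ} {y d : X} (h0 : 0 ≤ (fwdDiff d)^[n + 1] F y)
    (h1 : 0 ≤ (fwdDiff d)^[n + 1] F (y - d)) {m : ℝ}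
    (hm : ∀ i ∈ Finset.Icc (-((n + 1 : ℕ) : ℤ)) (n + 1 : ℕ), i ≠ 0 → ‖F (y + i • d)‖ ≤ m) :
    ‖F y‖ ≤ (2 * (n + 1) + 1) * ((n + 2) * (2 ^ (n + 1) * |m|)) := by
  -- `F y` is term 0 of the difference at `y`, with coefficient `(-1) ^ (n + 1)`, and term 1 of that
  -- at `y - d`, with coefficient `(-1) ^ n * (n + 1)`: one bounds `u` above, the other below.
  obtain ⟨R, hR, hR0⟩ := exists_norm_le_of_fwdDiff_iter_nonneg (i := 0) (by omega) h0 (m := m)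
    fun j hj hj0 => by
      have := hm j (Finset.mem_Icc.2 ⟨by omega, by omega⟩) (by omega)
      rwa [natCast_zsmul] at this
  obtain ⟨Q, hQ, hQ0⟩ := exists_norm_le_of_fwdDiff_iter_nonneg (i := 1) (by omega) h1 (m := m)
    fun j hj hj0 => by
      have := hm ((j : ℤ) - 1) (Finset.mem_Icc.2 ⟨by omega, by omega⟩) (by omega)
      rwa [sub_smul, one_smul, natCast_zsmul, ← add_sub_assoc,
        add_sub_right_comm] at this
  set A : ℝ := (n + 2) * (2 ^ (n + 1) * |m|) with hA
  have hR' : ‖R‖ ≤ A := by refine hR.trans_eq ?_; push_cast; ring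
  have hQ' : ‖Q‖ ≤ A := by refine hQ.trans_eq ?_; push_cast; ring
  set u : Y := (-1 : ℤ) ^ n • F y with hu
  have hun : ‖u‖ = ‖F y‖ := by
    rcases neg_one_pow_eq_or ℤ n with h3 | h3 <;> simp [hu, h3]
  have hR1 : u ≤ R := by
    have : 0 ≤ -u + R := by
      simpa [hu, pow_succ] using hR0
    rwa [neg_add_eq_sub, sub_nonneg] at this
  have hQ1 : -Q ≤ (n + 1) • u := by
    have : 0 ≤ (n + 1) • u + Q := by
      rw [one_smul, sub_add_cancel, Nat.add_sub_cancel, Nat.choose_one_right, mul_comm,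
        mul_smul, natCast_zsmul] at hQ0
      exact hQ0
    exact neg_le_iff_add_nonneg.2 this
  have hb := norm_le_of_mem_Icc hnorm hQ1 (nsmul_le_nsmul_right hR1 (n + 1))
  have hnR : ‖(n + 1) • R‖ ≤ (n + 1) * A := by
    rw [norm_nsmul_eq_natCast_mul]
    push_cast
    gcongr
  have hnu : ‖u‖ ≤ ‖(n + 1) • u‖ := by
    rw [norm_nsmul_eq_natCast_mul]
    refine le_mul_of_one_le_left (norm_nonneg _) ?_
    push_cast
    linarith [(Nat.cast_nonneg n : (0 : ℝ) ≤ n)]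
  have h5 := norm_add_le ((n + 1) • R) Q
  have hA0 : 0 ≤ A := by positivity
  have hnA : 0 ≤ (n : ℝ) * A := by positivity
  rw [norm_neg, sub_neg_eq_add] at hb
  rw [← hun]
  nlinarith

end

/-- An `n`-convex function bounded by `m` at the points `y + i • d`, `0 < |i| ≤ n + 1`, is bounded
at `y`. -/
theorem IsNConvexWRT.norm_le {X Y : Type*} [AddCommGroup X] [Module ℝ X] [NormedAddCommGroup Y]
    [NormedSpace ℝ Y] [PartialOrder Y] [IsOrderedAddMonoid Y]
    (hnorm : ∀ x y : Y, 0 ≤ x → x ≤ y → ‖x‖ ≤ ‖y‖) {n : ℕ} {S D : Set X} {f : D → Y}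
    (hf : IsNConvexWRT n S f) (hS : S ∪ (-S) ∪ {0} = Set.univ) {y d : X} {m : ℝ} (hy : y ∈ D)
    (hD : ∀ i ∈ Finset.Icc (-((n + 1 : ℕ) : ℤ)) (n + 1 : ℕ), i ≠ 0 → y + i • d ∈ D)
    (hm : ∀ i ∈ Finset.Icc (-((n + 1 : ℕ) : ℤ)) (n + 1 : ℕ), i ≠ 0 →
      ‖Function.extend Subtype.val f 0 (y + i • d)‖ ≤ m) :
    ‖Function.extend Subtype.val f 0 y‖ ≤
      (2 * (n + 1) + 1) * ((n + 2) * (2 ^ (n + 1) * |m|)) := by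
  have key : ∀ d ∈ S,
      (∀ i ∈ Finset.Icc (-((n + 1 : ℕ) : ℤ)) (n + 1 : ℕ), i ≠ 0 → y + i • d ∈ D) →
      (∀ i ∈ Finset.Icc (-((n + 1 : ℕ) : ℤ)) (n + 1 : ℕ), i ≠ 0 →
        ‖Function.extend Subtype.val f 0 (y + i • d)‖ ≤ m) →
      ‖Function.extend Subtype.val f 0 y‖ ≤
        (2 * (n + 1) + 1) * ((n + 2) * (2 ^ (n + 1) * |m|)) := by
    intro d hd hD hm
    have hD' : ∀ i ∈ Finset.Icc (-((n + 1 : ℕ) : ℤ)) (n + 1 : ℕ), y + i • d ∈ D := by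
      intro i hi
      rcases eq_or_ne i 0 with rfl | hi0
      · simpa using hy
      · exact hD i hi hi0
    refine norm_le_of_fwdDiff_iter_nonneg hnorm (hf.fwdDiff_iter_nonneg hd fun j hj => ?_)
      (hf.fwdDiff_iter_nonneg hd fun j hj => ?_) hm
    · have := hD' j (Finset.mem_Icc.2 ⟨by omega, by omega⟩)
      rwa [natCast_zsmul] at this
    · have := hD' ((j : ℤ) - 1) (Finset.mem_Icc.2 ⟨by omega, by omega⟩)
      rwa [sub_smul, one_smul, natCast_zsmul, ← add_sub_assoc,
        add_sub_right_comm] at this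
  have hmem : d ∈ S ∪ (-S) ∪ {0} := hS ▸ Set.mem_univ _
  rcases hmem with (hd | hd) | hd
  · exact key d hd hD hm
  · refine key (-d) hd (fun i hi hi0 => ?_) fun i hi hi0 => ?_
    · rw [smul_neg, ← neg_smul]
      rw [Finset.mem_Icc] at hi
      exact hD (-i) (Finset.mem_Icc.2 ⟨by omega, by omega⟩) (neg_ne_zero.2 hi0)
    · rw [smul_neg, ← neg_smul]
      rw [Finset.mem_Icc] at hi
      exact hm (-i) (Finset.mem_Icc.2 ⟨by omega, by omega⟩) (neg_ne_zero.2 hi0)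
  -- For `d = 0` the point with `i = 1` is `y` itself.
  · rw [Set.mem_singleton_iff] at hd
    have h1 := hm 1 (Finset.mem_Icc.2 ⟨by omega, by omega⟩) one_ne_zero
    rw [hd, smul_zero, add_zero] at h1
    refine (h1.trans (le_abs_self m)).trans ?_
    have h2 : (1 : ℝ) ≤ 2 ^ (n + 1) := one_le_pow₀ one_le_two
    have h3 : (1 : ℝ) ≤ 2 * (n + 1) + 1 := by linarith [(Nat.cast_nonneg n : (0 : ℝ) ≤ n)]
    have h4 : (1 : ℝ) ≤ n + 2 := by linarith [(Nat.cast_nonneg n : (0 : ℝ) ≤ n)]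
    calc |m| ≤ 2 ^ (n + 1) * |m| := le_mul_of_one_le_left (abs_nonneg _) h2
      _ ≤ (n + 2) * (2 ^ (n + 1) * |m|) := le_mul_of_one_le_left (by positivity) h4
      _ ≤ _ := le_mul_of_one_le_left (by positivity) h3

/-- A `𝒟`-measurable `n`-convex function is locally bounded. -/
theorem IsNConvexWRT.exists_eventually_norm_le
    {X : Type*} [AddCommGroup X] [Module ℝ X] [TopologicalSpace X]
    [IsTopologicalAddGroup X] [ContinuousSMul ℝ X] [IsCompletelyMetrizableSpace X]
    {Y : Type*} [NormedAddCommGroup Y] [NormedSpace ℝ Y] [PartialOrder Y] [IsOrderedAddMonoid Y]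
    (hnorm : ∀ x y : Y, 0 ≤ x → x ≤ y → ‖x‖ ≤ ‖y‖) {D : Set X} (hD : IsOpen D) {S : Set X}
    (hS : S ∪ (-S) ∪ {0} = Set.univ) {n : ℕ} {f : D → Y} (hf_meas : IsDMeasurableFun f)
    (hf : IsNConvexWRT n S f) {x₀ : X} (hx₀ : x₀ ∈ D) :
    ∃ C : ℝ, ∀ᶠ x in 𝓝 x₀, ‖Function.extend Subtype.val f 0 x‖ ≤ C := by
  by_contra! hunb
  set F : X → Y := Function.extend Subtype.val f 0 with hF
  let E : Finset ℤ := Finset.Icc (-((n + 1 : ℕ) : ℤ)) (n + 1 : ℕ)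
  have hE0 : (0 : ℤ) ∈ E := Finset.mem_Icc.2 ⟨by omega, by omega⟩
  -- the neighbourhood in which all the points used stay in the domain
  obtain ⟨W, hW, hWD⟩ : ∃ W ∈ 𝓝 (0 : X), ∀ a ∈ W, ∀ b ∈ W, ∀ i ∈ E,
      x₀ + (i : ℝ) • (a + b) ∈ D := by
    have hev : ∀ᶠ q in 𝓝 (0 : X) ×ˢ 𝓝 (0 : X), ∀ i ∈ E, x₀ + (i : ℝ) • (q.1 + q.2) ∈ D := by
      refine (Finset.eventually_all _).2 fun i _ => ?_
      have hc : Continuous fun q : X × X => x₀ + (i : ℝ) • (q.1 + q.2) := by fun_prop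
      have := hc.tendsto (0, 0)
      rw [nhds_prod_eq] at this
      exact this.eventually (hD.mem_nhds (by simpa using hx₀))
    obtain ⟨W, hW, h⟩ := mem_prod_same_iff.1 hev
    exact ⟨W, hW, fun a ha b hb => h (Set.mk_mem_prod ha hb)⟩
  obtain ⟨V, hV, hsum⟩ := exists_nhds_zero_forall_continuous_sum hW
  -- a fast null sequence along which the function is unbounded
  have hseq : ∀ k : ℕ, ∃ u : X, (k : ℝ) < ‖F (x₀ + u)‖ ∧ x₀ + u ∈ D ∧
      ∀ e ∈ E, (e : ℝ)⁻¹ • u ∈ V k := by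
    intro k
    have h1 : ∀ᶠ x in 𝓝 x₀, x ∈ D ∧ ∀ e ∈ E, (e : ℝ)⁻¹ • (x - x₀) ∈ V k := by
      refine Filter.Eventually.and (hD.mem_nhds hx₀) ((Finset.eventually_all _).2 fun e _ => ?_)
      have hc : Continuous fun x : X => (e : ℝ)⁻¹ • (x - x₀) := by fun_prop
      exact (hc.tendsto x₀).eventually (by simpa using hV k)
    obtain ⟨x, hx, hxD, hxV⟩ := ((hunb k).and_eventually h1).exists
    exact ⟨x - x₀, by simpa using hx, by simpa using hxD, hxV⟩
  choose u hu huD huV using hseq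
  -- As `0⁻¹ = 0`, the letter `0` contributes nothing to the series.
  obtain ⟨g, hg, hgW, hglim⟩ := hsum (fun _ => E) (fun k e => ((e : ℤ) : ℝ)⁻¹ • u k)
    (fun k => continuous_of_discreteTopology) fun k e => huV k e e.2
  have hgdiff : ∀ (ε : ℕ → E) k e, g (Function.update ε k e) =
      g (Function.update ε k ⟨0, hE0⟩) + ((e : ℤ) : ℝ)⁻¹ • u k := by
    intro ε k e
    refine tendsto_nhds_unique (hglim _) (((hglim _).add_const _).congr' ?_)
    filter_upwards [Ioi_mem_atTop k] with N hN
    rw [Finset.sum_eq_add_sum_sdiff_singleton_of_mem (Finset.mem_range.2 hN),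
      Finset.sum_eq_add_sum_sdiff_singleton_of_mem (Finset.mem_range.2 hN)]
    have hc : ∀ e', ∑ j ∈ Finset.range N \ {k}, ((Function.update ε k e' j : ℤ) : ℝ)⁻¹ • u j =
        ∑ j ∈ Finset.range N \ {k}, ((ε j : ℤ) : ℝ)⁻¹ • u j := fun e' =>
      Finset.sum_congr rfl fun j hj => by
        rw [Finset.mem_sdiff, Finset.mem_singleton] at hj
        rw [Function.update_of_ne hj.2]
    rw [hc, hc, Function.update_self, Function.update_self]
    simp [add_comm]
  -- the Borel parts of the preimages of balls
  choose B M hB hM hBM using fun m : ℕ => hf_meas (Metric.ball 0 m) Metric.isOpen_ball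
  have hBF : ∀ m, ∀ x ∈ B m, x ∈ D ∧ ‖F x‖ ≤ m := by
    intro m x hx
    have : x ∈ B m ∪ M m := Or.inl hx
    rw [← hBM m] at this
    obtain ⟨y, hy, rfl⟩ := this
    refine ⟨y.2, ?_⟩
    rw [hF, Subtype.val_injective.extend_apply]
    exact (mem_ball_zero_iff.1 hy).le
  have hFB : ∀ m : ℕ, ∀ x ∈ D, ‖F x‖ < m → x ∈ B m ∪ M m := by
    intro m x hx hxm
    rw [← hBM m]
    refine ⟨⟨x, hx⟩, ?_, rfl⟩
    rw [hF] at hxm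
    have := Subtype.val_injective.extend_apply f 0 ⟨x, hx⟩
    rw [this] at hxm
    exact mem_ball_zero_iff.2 hxm
  -- a translate avoiding the Haar meager parts
  obtain ⟨z, hzW, hz⟩ : ∃ z ∈ W, ∀ m : ℕ, ∀ i : ℤ, i ≠ 0 →
      IsMeagre {ε | x₀ + (i : ℝ) • (g ε + z) ∈ M m} := by
    have : Nonempty (ℕ × {i : ℤ // i ≠ 0}) := ⟨(0, ⟨1, one_ne_zero⟩)⟩
    obtain ⟨φ, hφ⟩ := exists_surjective_nat (ℕ × {i : ℤ // i ≠ 0})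
    obtain ⟨z, hzW, hz⟩ := exists_mem_nhds_forall_isMeagre_preimage
      (fun p => (hM (φ p).1).preimage_add_smul x₀ (Int.cast_ne_zero.2 (φ p).2.2)) hg hW
    refine ⟨z, hzW, fun m i hi => ?_⟩
    obtain ⟨p, hp⟩ := hφ (m, ⟨i, hi⟩)
    have := hz p
    rw [hp] at this
    exact this
  let P : ℕ → Set (ℕ → E) := fun m => {ε | ∀ i ∈ E, i ≠ 0 → x₀ + (i : ℝ) • (g ε + z) ∈ B m}
  have hPm : ∀ m, BaireMeasurableSet (P m) := by
    intro m
    have : P m = ⋂ i ∈ {i : ℤ | i ∈ E ∧ i ≠ 0}, {ε | x₀ + (i : ℝ) • (g ε + z) ∈ B m} := by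
      ext ε
      simp only [P, Set.mem_iInter, Set.mem_ofPred_eq, and_imp]
    rw [this]
    refine BaireMeasurableSet.biInter (Set.to_countable _) fun i _ => ?_
    have hc : Continuous fun ε => x₀ + (i : ℝ) • (g ε + z) :=
      continuous_const.add ((hg.add continuous_const).const_smul _)
    borelize X (ℕ → E)
    exact (hc.measurable (hB m)).baireMeasurableSet
  -- A generic `ε` avoids every `M m`; the finitely many values of `F` at its points are bounded, so
  -- it lies in some `P m`. Hence not all `P m` are meagre.
  obtain ⟨m, hm⟩ : ∃ m, ¬ IsMeagre (P m) := by
    by_contra! hall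
    have hev : ∀ᶠ ε in residual (ℕ → E), (∀ m, ε ∉ P m) ∧
        ∀ m : ℕ, ∀ i : {i : ℤ // i ≠ 0}, x₀ + ((i : ℤ) : ℝ) • (g ε + z) ∉ M m :=
      (eventually_countable_forall.2 fun m => hall m).and
        (eventually_countable_forall.2 fun m => eventually_countable_forall.2 fun i =>
          hz m i i.2)
    have : Nonempty E := ⟨⟨0, hE0⟩⟩
    obtain ⟨ε, hε, hεM⟩ := (dense_of_mem_residual hev).nonempty
    obtain ⟨c, hc⟩ := (E.finite_toSet.image fun i : ℤ =>
      ‖F (x₀ + (i : ℝ) • (g ε + z))‖).bddAbove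
    obtain ⟨m, hm⟩ := exists_nat_gt c
    refine hε m fun i hi hi0 => ?_
    refine (hFB m _ (hWD _ (hgW ε) _ hzW i hi) ?_).resolve_right (hεM m ⟨i, hi0⟩)
    exact (hc (Set.mem_image_of_mem _ hi)).trans_lt hm
  obtain ⟨k₀, hk₀⟩ := exists_forall_update_mem_of_not_isMeagre (hPm m) hm
  set A : ℝ := (2 * (n + 1) + 1) * ((n + 2) * (2 ^ (n + 1) * |(m : ℝ)|)) with hA
  obtain ⟨k₁, hk₁⟩ := exists_nat_gt A
  obtain ⟨ε, hε⟩ := hk₀ (max k₀ k₁) (le_max_left _ _)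
  set k := max k₀ k₁ with hk
  -- Putting `i` in place `k` adds `i⁻¹ • u k` to `g`, and the outer factor `i` turns this into `u
  -- k`, whatever `i` is.
  have hpt : ∀ i ∈ E, i ≠ 0 →
      x₀ + u k + i • (g (Function.update ε k ⟨0, hE0⟩) + z) ∈ B m := by
    intro i hi hi0
    have h1 := hε ⟨i, hi⟩ i hi hi0
    have hi' : (i : ℝ) ≠ 0 := Int.cast_ne_zero.2 hi0
    rw [hgdiff, add_right_comm, smul_add, smul_inv_smul₀ hi', Int.cast_smul_eq_zsmul,
      add_comm _ (u k), ← add_assoc] at h1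
    exact h1
  have hb := hf.norm_le hnorm hS (huD k) (fun i hi hi0 => (hBF m _ (hpt i hi hi0)).1)
    fun i hi hi0 => (hBF m _ (hpt i hi hi0)).2
  have h1 : (k₁ : ℝ) ≤ k := by exact_mod_cast le_max_right k₀ k₁
  linarith [hu k]

/-! ### Continuity of `𝒟`-measurable `n`-convex functions -/

theorem mainTheorem3
    {X : Type*} [AddCommGroup X] [Module ℝ X] [TopologicalSpace X]
    [IsTopologicalAddGroup X] [ContinuousSMul ℝ X] [PolishSpace X]
    {Y : Type*} [NormedAddCommGroup Y] [NormedSpace ℝ Y]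
    [PartialOrder Y] [IsOrderedAddMonoid Y] [PosSMulMono ℝ Y]
    (hnorm : ∀ x y : Y, 0 ≤ x → x ≤ y → ‖x‖ ≤ ‖y‖)
    (D : Set X) (hD_nonempty : D.Nonempty) (hD_open : IsOpen D) (hD_convex : Convex ℝ D)
    (S : Set X) (hS : IsConeSet S) (hS_univ : S ∪ (-S) ∪ {0} = Set.univ)
    (n : ℕ) (hn : 1 ≤ n)
    (f : D → Y) (hf_meas : IsDMeasurableFun f) (hf_conv : IsNConvexWRT n S f) :
    Continuous f := by
  rw [continuous_iff_continuousAt]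
  rintro ⟨x₀, hx₀⟩
  obtain ⟨C, hC⟩ := hf_conv.exists_eventually_norm_le hnorm hD_open hS_univ hf_meas hx₀
  have hev : ∀ᶠ p in 𝓝 (x₀, (0 : X)), p.1 ∈ D :=
    (continuous_fst.tendsto (x₀, (0 : X))).eventually (hD_open.mem_nhds hx₀)
  have hF : ContinuousAt (Function.extend Subtype.val f 0) x₀ := by
    refine continuousAt_of_eventually_norm_le_of_fwdDiff_iter_nonneg hnorm hC hS_univ hn ?_
    -- Close to `(x₀, 0)` the whole progression stays in the open set `D`, so the extension by zero
    -- inherits the convexity inequality.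
    filter_upwards [eventually_forall_add_zsmul hev (n + 1)] with p hp hpS
    refine hf_conv.fwdDiff_iter_nonneg hpS fun j hj => ?_
    have := hp j (Finset.mem_Icc.2 ⟨by omega, by omega⟩)
    rwa [natCast_zsmul] at this
  have hcomp : f = Function.extend Subtype.val f 0 ∘ Subtype.val :=
    (Function.extend_comp Subtype.val_injective f 0).symm
  rw [hcomp]
  exact ContinuousAt.comp (f := (Subtype.val : D → X)) hF continuous_subtype_val.continuousAt
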